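/- Let $s\in(-1,0)$. A function $g:\mathbb{R}\to\mathbb{R}_+=[0,\infty)$ is called $s$-concave if for all $\lambda\in[0,1]$ and all $x,y\in\mathbb{R}$ with $g(x)g(y)>0$ one has $$g((1-\lambda)x+\lambda y)\ge\big((1-\lambda)g(x)^s+\lambda g(y)^s\big)^{1/s}.$$ The $s$-polar of $g$ is $$\mathcal{L}_s g(y)=\inf_{x\in\mathbb{R},\,g(x)>0}\frac{(1-sxy)_+^{1/s}}{g(x)}\qquad(y\in\mathbb{R}),$$ where $t_+=\max(t,0)$ and $0^{1/s}=+\infty$. Let $g:\mathbb{R}\to\mathbb{R}_+$ be an even $s$-concave function with $0<\int_{\mathbb{R}}g<+\infty$. Then $$\int_{\mathbb{R}}g(x)\,dx\int_{\mathbb{R}}\mathcal{L}_s g(y)\,dy\ \ge\ \frac{4}{1+s}.$$ Equality holds if and only if there are $c>0$ and $a>0$ such that $g(x)=c\,\mathbf{1}_{[-a,a]}(x)$ for all $x\in\mathbb{R}\setminus\{-a,a\}$. In particular, if $g$ is moreover upper semicontinuous, then equality holds if and only if $g=c\,\mathbf{1}_{[-a,a]}$ for some $c>0$ and $a>0$.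 -/

import Mathlib

open scoped NNReal ENNReal

/-- `g : ℝ → ℝ₊` is `s`-concave: for all `x, y` with `g x * g y > 0` and all `t ∈ [0,1]`,
`g ((1-t)x + ty)` is at least the `s`-mean of `g x` and `g y` with weights `1-t` and `t`
(the geometric mean if `s = 0`). -/
def IsSConcave (s : ℝ) (g : ℝ → ℝ≥0) : Prop :=
  ∀ x y t : ℝ, 0 ≤ t → t ≤ 1 → 0 < g x * g y →
    (if s = 0 then (g x : ℝ) ^ (1 - t) * (g y : ℝ) ^ t
      else ((1 - t) * (g x : ℝ) ^ s + t * (g y : ℝ) ^ s) ^ (1 / s))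
      ≤ (g ((1 - t) * x + t * y) : ℝ)

/-- The `s`-polar `L_s g (y) = inf_{x : g x > 0} (1 - s x y)₊ ^ (1/s) / g x`
(with `exp (-x y)` as numerator if `s = 0`), with values in `[0, ∞]`.
`ENNReal.ofReal` is the positive part, and for `s < 0` the power `0 ^ (1/s)` is `∞`,
as it has to be. -/
noncomputable def sPolar (s : ℝ) (g : ℝ → ℝ≥0) (y : ℝ) : ℝ≥0∞ :=
  ⨅ (x : ℝ) (_ : 0 < g x),
    (if s = 0 then ENNReal.ofReal (Real.exp (-(x * y)))
      else ENNReal.ofReal (1 - s * (x * y)) ^ (1 / s)) / (g x : ℝ≥0∞)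

open MeasureTheory Set Filter Topology

/-- A function on `[0, ∞)` (extended arbitrarily to `ℝ`) that is nonincreasing, equals `1` at the
origin, decays at least like `1 / x`, and whose reciprocal is convex. -/
structure IsProfile (f : ℝ → ℝ) : Prop where
  nonneg : ∀ x, 0 ≤ x → 0 ≤ f x
  zero : f 0 = 1
  anti : AntitoneOn f (Ici 0)
  conc : ∀ x y t, 0 ≤ x → 0 ≤ y → 0 ≤ t → t ≤ 1 → 0 < f x → 0 < f y →
    ((1 - t) / f x + t / f y)⁻¹ ≤ f ((1 - t) * x + t * y)
  decay : ∃ C, ∀ x, 0 ≤ x → f x * (1 + x) ≤ C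

namespace IsProfile

variable {f : ℝ → ℝ}

theorem le_one (hf : IsProfile f) {x : ℝ} (hx : 0 ≤ x) : f x ≤ 1 :=
  hf.zero ▸ hf.anti (mem_Ici.2 le_rfl) (mem_Ici.2 hx) hx

theorem antitoneOn_rpow (hf : IsProfile f) {p : ℝ} (hp : 0 ≤ p) :
    AntitoneOn (fun x => f x ^ p) (Ici 0) := fun _ hx y hy hxy =>
  Real.rpow_le_rpow (hf.nonneg y hy) (hf.anti hx hy hxy) hp

theorem integrableOn_rpow (hf : IsProfile f) {p : ℝ} (hp : 1 < p) :
    IntegrableOn (fun x => f x ^ p) (Ioi 0) := by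
  obtain ⟨C, hC⟩ := hf.decay
  have hC0 : 0 ≤ C := by
    have := hC 0 le_rfl
    rw [hf.zero] at this
    linarith
  have hi := (integrableOn_add_rpow_Ioi_of_lt (a := -p) (c := 0) (m := 1)
    (by linarith) (by norm_num)).const_mul (C ^ p)
  refine Integrable.mono' hi ?_ ?_
  · exact (aemeasurable_restrict_of_antitoneOn measurableSet_Ioi
      ((hf.antitoneOn_rpow (by linarith)).mono Ioi_subset_Ici_self)).aestronglyMeasurable
  · refine (ae_restrict_iff' measurableSet_Ioi).2 (Eventually.of_forall fun x hx => ?_)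
    have hx0 : (0 : ℝ) ≤ x := le_of_lt hx
    have hx1 : (0 : ℝ) < x + 1 := by linarith
    rw [Real.norm_of_nonneg (Real.rpow_nonneg (hf.nonneg x hx0) p), Real.rpow_neg hx1.le,
      ← div_eq_mul_inv, ← Real.div_rpow hC0 hx1.le]
    refine Real.rpow_le_rpow (hf.nonneg x hx0) ?_ (by linarith)
    rw [le_div_iff₀ hx1, add_comm]
    exact hC x hx0

theorem integral_rpow_nonneg (hf : IsProfile f) (p : ℝ) : 0 ≤ ∫ x in Ioi 0, f x ^ p :=
  setIntegral_nonneg measurableSet_Ioi fun x hx => Real.rpow_nonneg (hf.nonneg x (le_of_lt hx)) p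

theorem mul_rpow_le_integral_Ioc (hf : IsProfile f) {p : ℝ} (hp : 1 < p) {u : ℝ} (hu : 0 ≤ u) :
    u * f u ^ p ≤ ∫ x in Ioc 0 u, f x ^ p := by
  have h := setIntegral_mono_on (μ := volume) (s := Ioc 0 u) (f := fun _ => f u ^ p)
    (g := fun x => f x ^ p) (by simp)
    ((hf.integrableOn_rpow hp).mono_set Ioc_subset_Ioi_self) measurableSet_Ioc
    (fun x hx => hf.antitoneOn_rpow (by linarith) hx.1.le hu hx.2)
  simpa [hu] using h

theorem integral_Ioc_add_Ioi (hf : IsProfile f) {p : ℝ} (hp : 1 < p) {u : ℝ} (hu : 0 ≤ u) :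
    (∫ x in Ioc 0 u, f x ^ p) + ∫ x in Ioi u, f x ^ p = ∫ x in Ioi 0, f x ^ p := by
  rw [← setIntegral_union Ioc_disjoint_Ioi_same measurableSet_Ioi
    ((hf.integrableOn_rpow hp).mono_set Ioc_subset_Ioi_self)
    ((hf.integrableOn_rpow hp).mono_set (Ioi_subset_Ioi hu)), Ioc_union_Ioi_eq_Ioi hu]

theorem integral_rpow_pos (hf : IsProfile f) {p : ℝ} (hp : 1 < p) (h : ∃ x > 0, 0 < f x) :
    0 < ∫ x in Ioi 0, f x ^ p := by
  obtain ⟨x, hx, hfx⟩ := h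
  have h1 := hf.mul_rpow_le_integral_Ioc hp hx.le
  have h2 := hf.integral_Ioc_add_Ioi hp hx.le
  have h3 : 0 ≤ ∫ y in Ioi x, f y ^ p := setIntegral_nonneg measurableSet_Ioi fun y hy =>
    Real.rpow_nonneg (hf.nonneg y (hx.le.trans (le_of_lt hy))) p
  have : 0 < x * f x ^ p := by positivity
  linarith

theorem harmonic_bernoulli {a b t q : ℝ} (ha : 0 < a) (hb : 0 < b) (ht : 0 ≤ t) (ht1 : t < 1)
    (hq : 1 ≤ q) :
    (1 + q * t) * a ^ q - q * t / b * a ^ (q + 1) ≤ ((1 - t) / a + t / b)⁻¹ ^ q := by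
  set z := t * (a / b - 1) with hz
  have hab : 0 < a / b := by positivity
  have hz1 : 0 < 1 + z := by
    rw [hz]; nlinarith [mul_nonneg ht hab.le]
  have e1 : ((1 - t) / a + t / b)⁻¹ = a * (1 + z)⁻¹ := by
    have : (1 - t) / a + t / b = (1 + z) / a := by rw [hz]; field_simp; ring
    rw [this, inv_div, div_eq_mul_inv]
  have h2 : 1 + q * ((1 + z)⁻¹ - 1) ≤ (1 + z)⁻¹ ^ q := by
    have := one_add_mul_self_le_rpow_one_add (s := (1 + z)⁻¹ - 1)
      (by have := inv_pos.2 hz1; linarith) hq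
    simpa using this
  have h3 : 1 - z ≤ (1 + z)⁻¹ := by
    rw [← one_div, le_div_iff₀ hz1]; nlinarith [sq_nonneg z]
  rw [e1, Real.mul_rpow ha.le (inv_pos.2 hz1).le, Real.rpow_add ha, Real.rpow_one]
  have h4 : 1 - q * z ≤ (1 + z)⁻¹ ^ q := by nlinarith
  calc _ = a ^ q * (1 - q * z) := by rw [hz]; field_simp; ring
    _ ≤ _ := by gcongr

theorem integral_comp_affine (F : ℝ → ℝ) {t : ℝ} (ht1 : t < 1) (u : ℝ) :
    (1 - t) * ∫ w in Ioi 0, F ((1 - t) * w + t * u) = ∫ x in Ioi (t * u), F x := by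
  have h := integral_comp_mul_left_Ioi (fun x => F (x + t * u)) 0 (sub_pos.2 ht1)
  rw [h, mul_zero, smul_eq_mul, ← mul_assoc, mul_inv_cancel₀ (sub_pos.2 ht1).ne', one_mul]
  have := (measurePreserving_add_right volume (t * u)).setIntegral_preimage_emb
    (measurableEmbedding_addRight (t * u)) F (Ioi (t * u))
  simpa using this

theorem integrableOn_comp_affine {F : ℝ → ℝ} {t : ℝ} (ht1 : t < 1) (u : ℝ)
    (hF : IntegrableOn F (Ioi (t * u))) :
    IntegrableOn (fun w => F ((1 - t) * w + t * u)) (Ioi 0) := by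
  rw [integrableOn_Ioi_comp_mul_left_iff (fun x => F (x + t * u)) 0 (sub_pos.2 ht1), mul_zero]
  have := (measurePreserving_add_right volume (t * u)).integrableOn_comp_preimage
    (f := F) (s := Ioi (t * u)) (measurableEmbedding_addRight (t * u))
  simpa [Function.comp_def] using this.2 hF

theorem mul_rpow_add_integral_le (hf : IsProfile f) {q : ℝ} (hq : 1 < q) {u : ℝ} (hu : 0 ≤ u)
    (hfu : 0 < f u) {t : ℝ} (ht : 0 < t) (ht1 : t < 1) :
    f u * (u * f (t * u) ^ q + (q * (1 - t) - 1) * ∫ x in Ioi 0, f x ^ q) ≤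
      q * (1 - t) * ∫ x in Ioi 0, f x ^ (q + 1) := by
  have htu : 0 ≤ t * u := by positivity
  have hi1 := hf.integrableOn_rpow hq
  have hi2 := hf.integrableOn_rpow (p := q + 1) (by linarith)
  have h1 : ∫ w in Ioi 0, ((1 + q * t) * f w ^ q - q * t / f u * f w ^ (q + 1)) ≤
      ∫ w in Ioi 0, f ((1 - t) * w + t * u) ^ q := by
    refine setIntegral_mono_on ((hi1.const_mul _).sub (hi2.const_mul _))
      (integrableOn_comp_affine ht1 u (hi1.mono_set (Ioi_subset_Ioi htu))) measurableSet_Ioi ?_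
    intro w hw
    have hw0 : (0 : ℝ) ≤ w := le_of_lt hw
    rcases (hf.nonneg w hw0).eq_or_lt with h0 | h0
    · rw [← h0, Real.zero_rpow (by linarith), Real.zero_rpow (by linarith)]
      simp only [mul_zero, sub_zero]
      refine Real.rpow_nonneg (hf.nonneg _ ?_) q
      have := mul_nonneg (sub_pos.2 ht1).le hw0
      linarith
    · refine (harmonic_bernoulli h0 hfu ht.le ht1 hq.le).trans ?_
      refine Real.rpow_le_rpow ?_ (hf.conc w u t hw0 hu ht.le ht1.le h0 hfu) (by linarith)
      have := sub_pos.2 ht1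
      positivity
  rw [integral_sub (hi1.const_mul _) (hi2.const_mul _), integral_const_mul,
    integral_const_mul] at h1
  have h2 := integral_comp_affine (fun x => f x ^ q) ht1 u
  have h3 := hf.integral_Ioc_add_Ioi hq htu
  have h4 := hf.mul_rpow_le_integral_Ioc hq htu
  set A := ∫ x in Ioi 0, f x ^ q
  set B := ∫ x in Ioi 0, f x ^ (q + 1)
  have h5 := mul_le_mul_of_nonneg_left h1 (sub_pos.2 ht1).le
  rw [h2] at h5
  have h6 : t * (u * f (t * u) ^ q + (q * (1 - t) - 1) * A) ≤ t * (q * (1 - t) * B / f u) := by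
    have e : (1 - t) * ((1 + q * t) * A - q * t / f u * B) =
        A + t * (q * (1 - t) - 1) * A - t * (q * (1 - t) * B / f u) := by field_simp; ring
    linarith
  have h7 := le_of_mul_le_mul_left h6 ht
  rw [le_div_iff₀ hfu] at h7
  linarith

/-- The basic recursive inequality between consecutive moments of a profile. -/
theorem mul_add_integral_le (hf : IsProfile f) {q : ℝ} (hq : 1 < q) {u : ℝ} (hu : 0 ≤ u) :
    f u * (u + (q - 1) * ∫ x in Ioi 0, f x ^ q) ≤ q * ∫ x in Ioi 0, f x ^ (q + 1) := by
  rcases (hf.nonneg u hu).eq_or_lt with h0 | hfu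
  · rw [← h0, zero_mul]
    exact mul_nonneg (by linarith) (hf.integral_rpow_nonneg _)
  have hlim : Tendsto (fun t => f (t * u)) (𝓝[>] 0) (𝓝 1) := by
    have hlow : Tendsto (fun t : ℝ => ((1 - t) + t / f u)⁻¹) (𝓝[>] 0) (𝓝 1) := by
      have : ContinuousAt (fun t : ℝ => ((1 - t) + t / f u)⁻¹) 0 := by
        refine ContinuousAt.inv₀ (by fun_prop) (by simp)
      have h := this.tendsto.mono_left (nhdsWithin_le_nhds (s := Ioi 0))
      simpa using h
    refine tendsto_of_tendsto_of_tendsto_of_le_of_le' hlow tendsto_const_nhds ?_ ?_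
    · filter_upwards [Ioo_mem_nhdsGT (zero_lt_one' ℝ)] with t ht
      have := hf.conc 0 u t le_rfl hu ht.1.le ht.2.le (by rw [hf.zero]; exact one_pos) hfu
      simpa [hf.zero] using this
    · filter_upwards [self_mem_nhdsWithin] with t ht
      exact hf.le_one (mul_nonneg (le_of_lt ht) hu)
  have ht0 : Tendsto (fun t : ℝ => t) (𝓝[>] 0) (𝓝 0) := nhdsWithin_le_nhds
  have hlim' : Tendsto (fun t => f (t * u) ^ q) (𝓝[>] 0) (𝓝 1) := by
    simpa using hlim.rpow_const (p := q) (Or.inl one_ne_zero)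
  have hs : Tendsto (fun t : ℝ => q * (1 - t)) (𝓝[>] 0) (𝓝 q) := by
    simpa using (ht0.const_sub 1).const_mul q
  have hl := ((hlim'.const_mul u).add
    ((hs.sub_const 1).mul_const (∫ x in Ioi 0, f x ^ q))).const_mul (f u)
  rw [mul_one] at hl
  refine le_of_tendsto_of_tendsto hl (hs.mul_const (∫ x in Ioi 0, f x ^ (q + 1))) ?_
  filter_upwards [Ioo_mem_nhdsGT (zero_lt_one' ℝ)] with t ht
  exact hf.mul_rpow_add_integral_le hq hu hfu ht.1 ht.2

end IsProfile

/-- The supremum of `(1 + u v) f u` over `u ≥ 0`; its reciprocal is the polar profile of `f`. -/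
noncomputable def profileGauge (f : ℝ → ℝ) (v : ℝ) : ℝ := ⨆ u : ℝ≥0, (1 + u * v) * f u

namespace IsProfile

variable {f : ℝ → ℝ}

theorem gauge_le {v M : ℝ} (h : ∀ u, 0 ≤ u → (1 + u * v) * f u ≤ M) : profileGauge f v ≤ M :=
  ciSup_le fun u => h u u.2

theorem le_gauge (hf : IsProfile f) {u v : ℝ} (hu : 0 ≤ u) (hv : 0 ≤ v) :
    (1 + u * v) * f u ≤ profileGauge f v := by
  obtain ⟨C, hC⟩ := hf.decay
  refine le_ciSup (f := fun u : ℝ≥0 => (1 + u * v) * f u) ⟨C * (1 + v), ?_⟩ ⟨u, hu⟩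
  rintro _ ⟨w, rfl⟩
  have hw := w.2
  have h1 := hC w hw
  have h2 := hf.nonneg w hw
  have h3 : 0 ≤ f w * (w : ℝ) := mul_nonneg h2 hw
  have h4 : 0 ≤ f w * v := mul_nonneg h2 hv
  change (1 + (w : ℝ) * v) * f w ≤ C * (1 + v)
  nlinarith [mul_le_mul_of_nonneg_right h1 (by linarith : (0 : ℝ) ≤ 1 + v)]

theorem one_le_gauge (hf : IsProfile f) {v : ℝ} (hv : 0 ≤ v) : 1 ≤ profileGauge f v := by
  simpa [hf.zero] using hf.le_gauge (le_refl 0) hv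

theorem gauge_pos (hf : IsProfile f) {v : ℝ} (hv : 0 ≤ v) : 0 < profileGauge f v :=
  one_pos.trans_le (hf.one_le_gauge hv)

/-- The polar of a profile is a profile. -/
theorem polar (hf : IsProfile f) (h : ∃ x > 0, 0 < f x) :
    IsProfile fun v => (profileGauge f v)⁻¹ where
  nonneg v hv := (inv_pos.2 (hf.gauge_pos hv)).le
  zero := by
    refine inv_eq_one.2 (le_antisymm (gauge_le fun u hu => ?_) (hf.one_le_gauge le_rfl))
    simpa using hf.le_one hu
  anti v hv w hw hvw := by
    refine inv_anti₀ (hf.gauge_pos hv) (gauge_le fun u hu => ?_)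
    refine le_trans ?_ (hf.le_gauge hu hw)
    have := hf.nonneg u hu
    gcongr
  conc x y t hx hy ht ht1 _ _ := by
    have hz : 0 ≤ (1 - t) * x + t * y := by
      have := sub_nonneg.2 ht1
      positivity
    simp only [div_inv_eq_mul]
    refine inv_anti₀ (hf.gauge_pos hz) (gauge_le fun u hu => ?_)
    have h1 := mul_le_mul_of_nonneg_left (hf.le_gauge hu hx) (sub_nonneg.2 ht1)
    have h2 := mul_le_mul_of_nonneg_left (hf.le_gauge hu hy) ht
    linarith
  decay := by
    obtain ⟨x, hx, hfx⟩ := h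
    refine ⟨(1 + 1 / x) / f x, fun v hv => ?_⟩
    have h1 := hf.le_gauge hx.le hv
    rw [inv_mul_le_iff₀ (hf.gauge_pos hv)]
    calc 1 + v ≤ (1 + x * v) * f x * ((1 + 1 / x) / f x) := by
          have : (1 + x * v) * f x * ((1 + 1 / x) / f x) = 1 + v + (1 / x + x * v) := by
            field_simp; ring
          have : 0 ≤ 1 / x + x * v := by positivity
          linarith
      _ ≤ _ := by gcongr

theorem integral_mul_recursion (hf : IsProfile f) (h : ∃ x > 0, 0 < f x) {q : ℝ} (hq : 1 < q) :
    1 + (q - 1) ^ 2 * ((∫ x in Ioi 0, f x ^ q) * ∫ x in Ioi 0, (profileGauge f x)⁻¹ ^ q) ≤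
      q ^ 2 * ((∫ x in Ioi 0, f x ^ (q + 1)) *
        ∫ x in Ioi 0, (profileGauge f x)⁻¹ ^ (q + 1)) := by
  have hG := hf.integral_rpow_pos hq h
  have hk := fun u (hu : 0 ≤ u) => hf.mul_add_integral_le hq hu
  have hH0 := (hf.polar h).integral_rpow_nonneg (q + 1)
  set A := ∫ x in Ioi 0, f x ^ q
  set B := ∫ x in Ioi 0, f x ^ (q + 1)
  set A' := ∫ x in Ioi 0, (profileGauge f x)⁻¹ ^ q
  set B' := ∫ x in Ioi 0, (profileGauge f x)⁻¹ ^ (q + 1)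
  have hq1 : 0 < q - 1 := by linarith
  set D := (q - 1) * A with hD
  have hDpos : 0 < D := by positivity
  have h1 : profileGauge f D⁻¹ ≤ q * B / D := by
    refine gauge_le fun u hu => ?_
    rw [le_div_iff₀ hDpos]
    calc (1 + u * D⁻¹) * f u * D = f u * (u + D) := by field_simp; ring
      _ ≤ _ := hk u hu
  have h2 : (profileGauge f D⁻¹)⁻¹ * (D⁻¹ + (q - 1) * A') ≤ q * B' :=
    (hf.polar h).mul_add_integral_le hq (inv_pos.2 hDpos).le
  rw [inv_mul_le_iff₀ (hf.gauge_pos (inv_pos.2 hDpos).le)] at h2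
  have h3 : D⁻¹ + (q - 1) * A' ≤ q * B / D * (q * B') :=
    h2.trans (mul_le_mul_of_nonneg_right h1 (by positivity))
  have h4 := mul_le_mul_of_nonneg_left h3 hDpos.le
  calc _ = D * (D⁻¹ + (q - 1) * A') := by
        rw [mul_add, mul_inv_cancel₀ hDpos.ne']; rw [hD]; ring
    _ ≤ _ := h4
    _ = _ := by field_simp

theorem mul_le_integral (hf : IsProfile f) {p : ℝ} (hp : 1 < p) (hp2 : p ≤ 2) {u : ℝ}
    (hu : 0 ≤ u) : u * f u ≤ ∫ x in Ioc 0 u, f x ^ p := by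
  rcases (hf.nonneg u hu).eq_or_lt with h0 | hfu
  · rw [← h0, mul_zero]
    exact setIntegral_nonneg measurableSet_Ioc fun x hx => Real.rpow_nonneg (hf.nonneg x hx.1.le) p
  rcases hu.eq_or_lt with rfl | hu0
  · simp
  set k := (1 / f u - 1) / u with hk
  have hk0 : 0 ≤ k := by
    have : 1 ≤ 1 / f u := by rw [le_div_iff₀ hfu]; linarith [hf.le_one hu]
    exact div_nonneg (by linarith) hu
  have hcont : ContinuousOn (fun x : ℝ => ((1 + k * x) ^ 2)⁻¹) (Icc 0 u) := by
    refine ContinuousOn.inv₀ (by fun_prop) fun x hx => ?_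
    have := mul_nonneg hk0 hx.1
    positivity
  have hint : ∫ x in (0 : ℝ)..u, ((1 + k * x) ^ 2)⁻¹ = u * f u := by
    rw [intervalIntegral.integral_eq_sub_of_hasDerivAt (f := fun x => x / (1 + k * x))]
    · have : 1 + k * u = 1 / f u := by rw [hk]; field_simp; ring
      simp [this]
    · intro x hx
      rw [uIcc_of_le hu] at hx
      have h1 : 1 + k * x ≠ 0 := by
        have := mul_nonneg hk0 hx.1
        positivity
      have := (hasDerivAt_id x).div (((hasDerivAt_id x).const_mul k).const_add 1) h1
      refine this.congr_deriv ?_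
      simp only [id]
      field_simp
      ring
    · exact (hcont.mono (by rw [uIcc_of_le hu])).intervalIntegrable
  rw [← hint, intervalIntegral.integral_of_le hu]
  refine setIntegral_mono_on ((hcont.integrableOn_Icc).mono_set Ioc_subset_Icc_self)
    ((hf.integrableOn_rpow hp).mono_set Ioc_subset_Ioi_self) measurableSet_Ioc fun x hx => ?_
  have hkx := mul_nonneg hk0 hx.1.le
  have hxu : x / u ≤ 1 := (div_le_one hu0).2 hx.2
  have h1 := hf.conc 0 u (x / u) le_rfl hu (div_nonneg hx.1.le hu) hxu
    (by rw [hf.zero]; exact one_pos) hfu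
  have e1 : (1 - x / u) / f 0 + x / u / f u = 1 + k * x := by
    rw [hf.zero, hk]; field_simp; ring
  have e2 : (1 - x / u) * 0 + x / u * u = x := by field_simp; ring
  rw [e1, e2] at h1
  have hpos : 0 < (1 + k * x)⁻¹ := by positivity
  calc ((1 + k * x) ^ 2)⁻¹ = (1 + k * x)⁻¹ ^ (2 : ℝ) := by
        rw [← inv_pow, Real.rpow_ofNat]
    _ ≤ (1 + k * x)⁻¹ ^ p :=
        Real.rpow_le_rpow_of_exponent_ge hpos (h1.trans (hf.le_one hx.1.le)) hp2
    _ ≤ f x ^ p := Real.rpow_le_rpow hpos.le h1 (by linarith)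

theorem integrableOn_affine_rpow {p a : ℝ} (hp : 1 < p) (ha : 0 < a) :
    IntegrableOn (fun v : ℝ => (1 + a * v)⁻¹ ^ p) (Ioi 0) := by
  rw [integrableOn_Ioi_comp_mul_left_iff (fun x : ℝ => (1 + x)⁻¹ ^ p) 0 ha, mul_zero]
  refine (integrableOn_add_rpow_Ioi_of_lt (a := -p) (c := 0) (m := 1)
    (by linarith) (by norm_num)).congr_fun (fun x hx => ?_) measurableSet_Ioi
  have : (0 : ℝ) ≤ x + 1 := by linarith [mem_Ioi.1 hx]
  simp only
  rw [Real.rpow_neg this, Real.inv_rpow (by linarith), add_comm]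

theorem integral_affine_rpow {p a : ℝ} (hp : 1 < p) (ha : 0 < a) :
    ∫ v in Ioi (0 : ℝ), (1 + a * v)⁻¹ ^ p = 1 / (a * (p - 1)) := by
  rw [integral_comp_mul_left_Ioi (fun x : ℝ => (1 + x)⁻¹ ^ p) 0 ha, mul_zero]
  have h1 : ∫ x in Ioi (0 : ℝ), (1 + x)⁻¹ ^ p = ∫ x in Ioi (1 : ℝ), x⁻¹ ^ p := by
    have := (measurePreserving_add_left volume (1 : ℝ)).setIntegral_preimage_emb
      (measurableEmbedding_addLeft (1 : ℝ)) (fun x => x⁻¹ ^ p) (Ioi 1)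
    simpa using this
  have h2 : ∫ x in Ioi (1 : ℝ), x⁻¹ ^ p = ∫ x in Ioi (1 : ℝ), x ^ (-p) := by
    refine setIntegral_congr_fun measurableSet_Ioi fun x hx => ?_
    have : (0 : ℝ) ≤ x := by linarith [mem_Ioi.1 hx]
    rw [Real.rpow_neg this, Real.inv_rpow this]
  rw [h1, h2, integral_Ioi_rpow_of_lt (by linarith) one_pos, Real.one_rpow, smul_eq_mul]
  have : p - 1 ≠ 0 := by linarith
  have : -p + 1 ≠ 0 := by intro h; apply this; linarith
  field_simp
  ring

theorem gauge_le_affine (hf : IsProfile f) {p : ℝ} (hp : 1 < p) (hp2 : p ≤ 2) {v : ℝ}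
    (hv : 0 ≤ v) : profileGauge f v ≤ 1 + (∫ x in Ioi 0, f x ^ p) * v := by
  refine gauge_le fun u hu => ?_
  have h1 := hf.le_one hu
  have h2 : u * f u ≤ ∫ x in Ioi 0, f x ^ p :=
    (hf.mul_le_integral hp hp2 hu).trans <| setIntegral_mono_set (hf.integrableOn_rpow hp)
      ((ae_restrict_iff' measurableSet_Ioi).2 (Eventually.of_forall fun x hx =>
        Real.rpow_nonneg (hf.nonneg x (le_of_lt hx)) p)) Ioc_subset_Ioi_self.eventuallyLE
  nlinarith [mul_le_mul_of_nonneg_right h2 hv]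

theorem inv_affine_le (hf : IsProfile f) {p : ℝ} (hp : 1 < p) (hp2 : p ≤ 2) {v : ℝ}
    (hv : 0 ≤ v) :
    (1 + (∫ x in Ioi 0, f x ^ p) * v)⁻¹ ^ p ≤ (profileGauge f v)⁻¹ ^ p := by
  have := mul_nonneg (hf.integral_rpow_nonneg p) hv
  exact Real.rpow_le_rpow (by positivity)
    (inv_anti₀ (hf.gauge_pos hv) (hf.gauge_le_affine hp hp2 hv)) (by linarith)

/-- A profile which is the indicator of an interval, up to the value at the endpoint. -/
def IsFlat (f : ℝ → ℝ) : Prop :=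
  ∃ a > 0, (∀ x, 0 ≤ x → x < a → f x = 1) ∧ ∀ x, a < x → f x = 0

theorem isFlat_of_gauge_eq (hf : IsProfile f) (h : ∃ x > 0, 0 < f x) {p : ℝ} (hp : 1 < p)
    (hp2 : p ≤ 2) {v : ℝ} (hv : 0 < v)
    (he : profileGauge f v = 1 + (∫ x in Ioi 0, f x ^ p) * v) : IsFlat f := by
  have hG := hf.integral_rpow_pos hp h
  have hsplit := fun u (hu : 0 ≤ u) => hf.integral_Ioc_add_Ioi hp hu
  have hub : ∀ u, 0 ≤ u → u * f u ≤ ∫ x in Ioi 0, f x ^ p := fun u hu => by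
    have h1 := hf.mul_le_integral hp hp2 hu
    have h2 : 0 ≤ ∫ y in Ioi u, f y ^ p := setIntegral_nonneg measurableSet_Ioi fun y hy =>
      Real.rpow_nonneg (hf.nonneg y (hu.trans (le_of_lt hy))) p
    linarith [hsplit u hu]
  set G := ∫ x in Ioi 0, f x ^ p with hGdef
  have hflat : ∀ x, 0 ≤ x → x < G → f x = 1 := by
    intro x hx hxG
    refine le_antisymm (hf.le_one hx) (le_of_forall_pos_sub_le fun ε hε => ?_)
    set δ := min ε ((G - x) * v) with hδ
    have hδ0 : 0 < δ := lt_min hε (mul_pos (sub_pos.2 hxG) hv)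
    obtain ⟨u, hu⟩ := exists_lt_of_lt_ciSup (f := fun u : ℝ≥0 => (1 + u * v) * f u)
      (show 1 + G * v - δ < profileGauge f v by rw [he]; linarith)
    have hu0 : (0 : ℝ) ≤ u := u.2
    have h1 := hf.le_one hu0
    have h2 := mul_le_mul_of_nonneg_right (hub u hu0) hv.le
    have h3 : 1 - δ < f u := by linarith
    have h4 : (G - x) * v + (u * f u - G) * v > 0 := by
      have := min_le_right ε ((G - x) * v)
      linarith
    have h5 : x < u * f u := by
      by_contra hc
      nlinarith
    have h6 : x ≤ u := by nlinarith
    have h7 := hf.anti (mem_Ici.2 hx) (mem_Ici.2 hu0) h6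
    linarith [min_le_left ε ((G - x) * v)]
  refine ⟨G, hG, hflat, fun x hx => ?_⟩
  by_contra hne
  have hx0 : 0 < x := hG.trans hx
  have hfx : 0 < f x := lt_of_le_of_ne (hf.nonneg x hx0.le) (Ne.symm hne)
  have h1 : ∫ y in Ioc 0 G, f y ^ p = G := by
    have : ∫ y in Ioc 0 G, f y ^ p = ∫ y in Ioo 0 G, (1 : ℝ) := by
      rw [integral_Ioc_eq_integral_Ioo]
      refine setIntegral_congr_fun measurableSet_Ioo fun y hy => ?_
      simp [hflat y hy.1.le hy.2]
    rw [this]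
    simp [hG.le]
  have h2 := hsplit G hG.le
  have h3 : (x - G) * f x ^ p ≤ ∫ y in Ioc G x, f y ^ p := by
    have h := setIntegral_mono_on (μ := volume) (s := Ioc G x) (f := fun _ => f x ^ p)
      (g := fun y => f y ^ p) (by simp)
      ((hf.integrableOn_rpow hp).mono_set fun y hy => hG.trans hy.1) measurableSet_Ioc
      (fun y hy => hf.antitoneOn_rpow (by linarith) (mem_Ici.2 (hG.le.trans hy.1.le))
        (mem_Ici.2 hx0.le) hy.2)
    simpa [hx.le] using h
  have h4 : ∫ y in Ioc G x, f y ^ p ≤ ∫ y in Ioi G, f y ^ p :=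
    setIntegral_mono_set ((hf.integrableOn_rpow hp).mono_set (Ioi_subset_Ioi hG.le))
      ((ae_restrict_iff' measurableSet_Ioi).2 (Eventually.of_forall fun y hy =>
        Real.rpow_nonneg (hf.nonneg y (hG.le.trans (le_of_lt hy))) p))
      Ioc_subset_Ioi_self.eventuallyLE
  have h5 : 0 < (x - G) * f x ^ p := mul_pos (sub_pos.2 hx) (Real.rpow_pos_of_pos hfx p)
  linarith

theorem one_le_of_le_two (hf : IsProfile f) (h : ∃ x > 0, 0 < f x) {p : ℝ} (hp : 1 < p)
    (hp2 : p ≤ 2) :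
    1 ≤ (p - 1) * ((∫ x in Ioi 0, f x ^ p) * ∫ x in Ioi 0, (profileGauge f x)⁻¹ ^ p) ∧
    ((p - 1) * ((∫ x in Ioi 0, f x ^ p) * ∫ x in Ioi 0, (profileGauge f x)⁻¹ ^ p) = 1 →
      IsFlat f) := by
  have hG := hf.integral_rpow_pos hp h
  have hle : ∀ v ∈ Ioi (0 : ℝ), _ := fun v hv => hf.inv_affine_le hp hp2 (le_of_lt hv)
  have hflat := fun v (hv : 0 < v) => hf.isFlat_of_gauge_eq h hp hp2 (v := v) hv
  set G := ∫ x in Ioi 0, f x ^ p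
  have hi1 := integrableOn_affine_rpow hp hG
  have hi2 := (hf.polar h).integrableOn_rpow hp
  have hI := integral_affine_rpow hp hG
  have hp1 : 0 < p - 1 := by linarith
  have hmono := setIntegral_mono_on hi1 hi2 measurableSet_Ioi hle
  rw [hI] at hmono
  have e1 : (p - 1) * (G * (1 / (G * (p - 1)))) = 1 := by field_simp
  refine ⟨?_, fun he => ?_⟩
  · have := mul_le_mul_of_nonneg_left (mul_le_mul_of_nonneg_left hmono hG.le) hp1.le
    rwa [e1] at this
  · have heq : ∫ x in Ioi 0, (profileGauge f x)⁻¹ ^ p = 1 / (G * (p - 1)) := by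
      rw [eq_div_iff (by positivity)]; linarith
    have hz : ∫ v in Ioi (0 : ℝ), ((profileGauge f v)⁻¹ ^ p - (1 + G * v)⁻¹ ^ p) = 0 := by
      rw [integral_sub hi2 hi1, heq, hI, sub_self]
    rw [setIntegral_eq_zero_iff_of_nonneg_ae
      ((ae_restrict_iff' measurableSet_Ioi).2 (Eventually.of_forall fun v hv =>
        sub_nonneg.2 (hle v hv))) (hi2.sub hi1)] at hz
    have hz' := (ae_restrict_iff' measurableSet_Ioi).1 hz
    obtain ⟨v, hv, hv0⟩ : ∃ v, (v ∈ Ioi (0 : ℝ) →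
        (profileGauge f v)⁻¹ ^ p - (1 + G * v)⁻¹ ^ p = 0) ∧ v ∈ Ioi (0 : ℝ) := by
      by_contra! hc
      have : volume (Ioi (0 : ℝ)) = 0 :=
        measure_mono_null (fun v hv hgood => (hc v hgood) hv) hz'
      simp at this
    have hv0' : (0 : ℝ) < v := hv0
    refine hflat v hv0 ?_
    have h1 := sub_eq_zero.1 (hv hv0)
    have h2 := (Real.rpow_left_inj (inv_pos.2 (hf.gauge_pos hv0'.le)).le (by positivity)
      (by linarith)).1 h1
    exact inv_injective h2

theorem one_le_integral_mul (hf : IsProfile f) (h : ∃ x > 0, 0 < f x) (n : ℕ) :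
    ∀ p : ℝ, 1 < p → p ≤ n + 2 →
    1 ≤ (p - 1) * ((∫ x in Ioi 0, f x ^ p) * ∫ x in Ioi 0, (profileGauge f x)⁻¹ ^ p) ∧
    ((p - 1) * ((∫ x in Ioi 0, f x ^ p) * ∫ x in Ioi 0, (profileGauge f x)⁻¹ ^ p) = 1 →
      IsFlat f) := by
  induction n with
  | zero => exact fun p hp hp2 => hf.one_le_of_le_two h hp (by simpa using hp2)
  | succ n ih =>
    intro p hp hpn
    rcases le_or_gt p 2 with hp2 | hp2
    · exact hf.one_le_of_le_two h hp hp2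
    have hq : 1 < p - 1 := by linarith
    obtain ⟨h1, h2⟩ := ih (p - 1) hq (by push_cast at hpn; linarith)
    have h3 := hf.integral_mul_recursion h hq
    rw [sub_add_cancel] at h3
    set X := (∫ x in Ioi 0, f x ^ (p - 1)) * ∫ x in Ioi 0, (profileGauge f x)⁻¹ ^ (p - 1)
    set Y := (∫ x in Ioi 0, f x ^ p) * ∫ x in Ioi 0, (profileGauge f x)⁻¹ ^ p
    have hq1 : 0 < p - 1 - 1 := by linarith
    have h4 := mul_le_mul_of_nonneg_left h1 hq1.le
    refine ⟨?_, fun he => h2 (le_antisymm ?_ h1)⟩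
    · by_contra! hc
      nlinarith
    · by_contra! hc
      have := mul_lt_mul_of_pos_left hc hq1
      have : (p - 1) ^ 2 * Y = p - 1 := by rw [sq, mul_assoc, he, mul_one]
      nlinarith

end IsProfile

theorem lintegral_even {F : ℝ → ℝ≥0∞} (hF : Function.Even F) :
    ∫⁻ x, F x = 2 * ∫⁻ x in Ioi 0, F x := by
  have h1 : ∫⁻ x in Iio (0 : ℝ), F x = ∫⁻ x in Ioi 0, F x := by
    have := (Measure.measurePreserving_neg (volume : Measure ℝ)).setLIntegral_comp_preimage_emb
      (MeasurableEquiv.neg ℝ).measurableEmbedding F (Ioi 0)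
    rw [← this]
    simp [hF _]
  rw [← lintegral_add_compl F (measurableSet_Ioi (a := (0 : ℝ))), compl_Ioi,
    setLIntegral_congr Iio_ae_eq_Iic.symm, h1, two_mul]

theorem exists_pos_of_lintegral_pos {g : ℝ → ℝ≥0} (heven : Function.Even g)
    (hpos : 0 < ∫⁻ x, (g x : ℝ≥0∞)) : ∃ x > 0, 0 < g x := by
  by_contra! hc
  have : ∫⁻ x in Ioi (0 : ℝ), (g x : ℝ≥0∞) = 0 := by
    rw [setLIntegral_congr_fun (g := fun _ => 0) measurableSet_Ioi, lintegral_zero]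
    intro x hx
    simpa using hc x hx
  rw [lintegral_even (fun x => by rw [heven x]), this, mul_zero] at hpos
  exact lt_irrefl _ hpos

/-- The profile attached to an even `s`-concave function. -/
noncomputable def sProfile (s : ℝ) (g : ℝ → ℝ≥0) (x : ℝ) : ℝ := ((g x : ℝ) / g 0) ^ (-s)

namespace IsSConcave

variable {s : ℝ} {g : ℝ → ℝ≥0}

theorem antitoneOn (hs0 : s < 0) (heven : Function.Even g) (hconc : IsSConcave s g) :
    AntitoneOn g (Ici 0) := by
  intro w hw u hu hwu
  rcases eq_zero_or_pos (g u) with h0 | hgu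
  · rw [h0]; exact zero_le
  rcases (mem_Ici.1 hu).eq_or_lt with h0 | hu0
  · rw [← h0] at hwu ⊢
    rw [le_antisymm hwu hw]
  have hwu' : w / u ≤ 1 := (div_le_one hu0).2 hwu
  have hwu0 : 0 ≤ w / u := div_nonneg hw hu
  have h := hconc (-u) u ((1 + w / u) / 2) (by linarith) (by linarith)
    (by rw [heven u]; exact mul_pos hgu hgu)
  rw [if_neg hs0.ne, heven u, ← add_mul, sub_add_cancel, one_mul, one_div,
    Real.rpow_rpow_inv (g u).coe_nonneg hs0.ne] at h
  have e : (1 - (1 + w / u) / 2) * -u + (1 + w / u) / 2 * u = w := by field_simp; ring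
  rw [e] at h
  exact_mod_cast h

theorem sProfile_pos_iff (hs0 : s < 0) (h0 : 0 < g 0) (x : ℝ) : 0 < sProfile s g x ↔ 0 < g x := by
  have h0' : (0 : ℝ) < g 0 := h0
  constructor
  · intro h
    by_contra hc
    have : g x = 0 := by simpa using hc
    rw [sProfile, this, NNReal.coe_zero, zero_div, Real.zero_rpow (by linarith)] at h
    exact lt_irrefl _ h
  · intro h
    have h' : (0 : ℝ) < g x := h
    unfold sProfile
    positivity

theorem eq_mul_sProfile_rpow (hs0 : s < 0) (h0 : 0 < g 0) (x : ℝ) :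
    (g x : ℝ) = g 0 * sProfile s g x ^ (-(1 / s)) := by
  have h0' : (0 : ℝ) < g 0 := h0
  rw [sProfile, ← Real.rpow_mul (by positivity)]
  have : -s * -(1 / s) = 1 := by rw [neg_mul_neg, mul_one_div_cancel hs0.ne]
  rw [this, Real.rpow_one]
  field_simp

theorem sProfile_zero (h0 : 0 < g 0) : sProfile s g 0 = 1 := by
  have h0' : (g 0 : ℝ) ≠ 0 := by exact_mod_cast h0.ne'
  rw [sProfile, div_self h0', Real.one_rpow]

theorem sProfile_conc (hs0 : s < 0) (hconc : IsSConcave s g) (h0 : 0 < g 0) {x y t : ℝ}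
    (ht : 0 ≤ t) (ht1 : t ≤ 1) (hx : 0 < sProfile s g x) (hy : 0 < sProfile s g y) :
    ((1 - t) / sProfile s g x + t / sProfile s g y)⁻¹ ≤ sProfile s g ((1 - t) * x + t * y) := by
  rw [sProfile_pos_iff hs0 h0] at hx hy
  have h0' : (0 : ℝ) < g 0 := h0
  have hx' : (0 : ℝ) < g x := hx
  have hy' : (0 : ℝ) < g y := hy
  have h := hconc x y t ht ht1 (mul_pos hx hy)
  rw [if_neg hs0.ne] at h
  have hxs := Real.rpow_pos_of_pos hx' s
  have hys := Real.rpow_pos_of_pos hy' s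
  have h0s := Real.rpow_pos_of_pos h0' s
  set A := (1 - t) * (g x : ℝ) ^ s + t * (g y : ℝ) ^ s with hA
  have hApos : 0 < A := by
    rcases ht.eq_or_lt with rfl | ht0
    · simpa [hA] using hxs
    · have := mul_nonneg (sub_nonneg.2 ht1) hxs.le
      have := mul_pos ht0 hys
      linarith
  have h1 := Real.rpow_le_rpow (Real.rpow_nonneg hApos.le _) h (by linarith : 0 ≤ -s)
  have e1 : (A ^ (1 / s)) ^ (-s) = A⁻¹ := by
    rw [← Real.rpow_mul hApos.le]
    have : 1 / s * -s = -1 := by rw [mul_neg, one_div_mul_cancel hs0.ne]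
    rw [this, Real.rpow_neg_one]
  have hP : ∀ z, sProfile s g z = (g z : ℝ) ^ (-s) * (g 0 : ℝ) ^ s := fun z => by
    rw [sProfile, Real.div_rpow (g z).coe_nonneg h0'.le, Real.rpow_neg h0'.le, div_inv_eq_mul]
  rw [e1] at h1
  rw [hP, hP, hP, Real.rpow_neg hx'.le, Real.rpow_neg hy'.le]
  have e2 : (1 - t) / (((g x : ℝ) ^ s)⁻¹ * (g 0 : ℝ) ^ s) +
      t / (((g y : ℝ) ^ s)⁻¹ * (g 0 : ℝ) ^ s) = A / (g 0 : ℝ) ^ s := by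
    rw [hA]; field_simp
  rw [e2, inv_div, div_eq_mul_inv, mul_comm]
  gcongr

theorem mul_sProfile_le (hs0 : s < 0) (heven : Function.Even g) (hconc : IsSConcave s g)
    (h0 : 0 < g 0) (hfin : ∫⁻ x, (g x : ℝ≥0∞) < ∞) {u : ℝ} (hu : 0 ≤ u) :
    u * sProfile s g u ≤ (∫⁻ x, (g x : ℝ≥0∞)).toReal / (g 0 * (1 / 2) ^ (-(1 / s))) := by
  have h0' : (0 : ℝ) < g 0 := h0
  have hden : (0 : ℝ) < g 0 * (1 / 2) ^ (-(1 / s)) := by positivity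
  have hnn : 0 ≤ sProfile s g u := Real.rpow_nonneg (by positivity) _
  rcases hnn.eq_or_lt with hz | hfu
  · rw [← hz, mul_zero]; positivity
  rcases hu.eq_or_lt with rfl | hu0
  · rw [zero_mul]; positivity
  rw [le_div_iff₀ hden]
  have hlow : ∀ x ∈ Icc 0 (u * sProfile s g u), g 0 * (1 / 2) ^ (-(1 / s)) ≤ (g x : ℝ) := by
    intro x hx
    have hle1 : sProfile s g u ≤ 1 := by
      refine Real.rpow_le_one (by positivity) ((div_le_one h0').2 ?_) (by linarith)
      exact_mod_cast antitoneOn hs0 heven hconc (mem_Ici.2 le_rfl) (mem_Ici.2 hu) hu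
    have hxu : x / u ≤ sProfile s g u := by rw [div_le_iff₀ hu0, mul_comm]; exact hx.2
    have hxu0 : 0 ≤ x / u := div_nonneg hx.1 hu
    have h1 := sProfile_conc hs0 hconc h0 (x := 0) (y := u) hxu0 (hxu.trans hle1)
      (by rw [sProfile_zero h0]; exact one_pos) hfu
    have e : (1 - x / u) * 0 + x / u * u = x := by field_simp; ring
    rw [e, sProfile_zero h0] at h1
    have h2 : x / u / sProfile s g u ≤ 1 := (div_le_one hfu).2 hxu
    have h3 : 0 ≤ x / u / sProfile s g u := div_nonneg hxu0 hfu.le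
    have h4 : (1 : ℝ) / 2 ≤ sProfile s g x := by
      refine le_trans ?_ h1
      rw [one_div]
      refine inv_anti₀ ?_ (by linarith)
      rcases hxu0.eq_or_lt with hz | hz
      · rw [← hz]; norm_num
      · have : 0 < x / u / sProfile s g u := div_pos hz hfu
        linarith
    rw [eq_mul_sProfile_rpow hs0 h0 x]
    refine mul_le_mul_of_nonneg_left (Real.rpow_le_rpow (by norm_num) h4 ?_) h0'.le
    rw [← one_div_neg_eq_neg_one_div]
    exact div_nonneg zero_le_one (by linarith)
  have h5 : ENNReal.ofReal (u * sProfile s g u * (g 0 * (1 / 2) ^ (-(1 / s)))) ≤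
      ∫⁻ x, (g x : ℝ≥0∞) := by
    calc _ = ∫⁻ _ in Icc 0 (u * sProfile s g u),
          ENNReal.ofReal (g 0 * (1 / 2) ^ (-(1 / s))) := by
          rw [setLIntegral_const, Real.volume_Icc, sub_zero, ← ENNReal.ofReal_mul hden.le, mul_comm]
      _ ≤ ∫⁻ x in Icc 0 (u * sProfile s g u), (g x : ℝ≥0∞) := by
          refine setLIntegral_mono' measurableSet_Icc fun x hx => ?_
          rw [← ENNReal.ofReal_coe_nnreal]
          exact ENNReal.ofReal_le_ofReal (hlow x hx)
      _ ≤ _ := setLIntegral_le_lintegral _ _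
  exact (ENNReal.ofReal_le_iff_le_toReal hfin.ne).1 h5

theorem isProfile (hs0 : s < 0) (heven : Function.Even g) (hconc : IsSConcave s g)
    (h0 : 0 < g 0) (hfin : ∫⁻ x, (g x : ℝ≥0∞) < ∞) : IsProfile (sProfile s g) where
  nonneg x _ := Real.rpow_nonneg (by positivity) _
  zero := sProfile_zero h0
  anti x hx y hy hxy := by
    refine Real.rpow_le_rpow (by positivity) ?_ (by linarith)
    have : (g y : ℝ) ≤ g x := by exact_mod_cast antitoneOn hs0 heven hconc hx hy hxy
    gcongr
  conc x y t _ _ ht ht1 hx hy := sProfile_conc hs0 hconc h0 ht ht1 hx hy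
  decay := by
    refine ⟨1 + (∫⁻ x, (g x : ℝ≥0∞)).toReal / (g 0 * (1 / 2) ^ (-(1 / s))), fun x hx => ?_⟩
    have h1 := mul_sProfile_le hs0 heven hconc h0 hfin hx
    have h2 : sProfile s g x ≤ 1 := by
      have h0' : (0 : ℝ) < g 0 := h0
      refine Real.rpow_le_one (by positivity) ((div_le_one h0').2 ?_) (by linarith)
      exact_mod_cast antitoneOn hs0 heven hconc (mem_Ici.2 le_rfl) (mem_Ici.2 hx) hx
    linarith

theorem lintegral_eq (hs : -1 < s) (hs0 : s < 0) (heven : Function.Even g) (h0 : 0 < g 0)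
    (hf : IsProfile (sProfile s g)) :
    ∫⁻ x, (g x : ℝ≥0∞) =
      ENNReal.ofReal (2 * (g 0 * ∫ x in Ioi 0, sProfile s g x ^ (-(1 / s)))) := by
  have hp : 1 < -(1 / s) := by
    rw [← one_div_neg_eq_neg_one_div, lt_div_iff₀ (by linarith)]; linarith
  rw [lintegral_even (fun x => by rw [heven x]), ENNReal.ofReal_mul zero_le_two,
    ENNReal.ofReal_ofNat, ← integral_const_mul, ofReal_integral_eq_lintegral_ofReal
      ((hf.integrableOn_rpow hp).const_mul _)]
  · congr 1
    refine lintegral_congr fun x => ?_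
    rw [← eq_mul_sProfile_rpow hs0 h0, ENNReal.ofReal_coe_nnreal]
  · refine Eventually.of_forall fun x => ?_
    simp only [Pi.zero_apply]
    rw [← eq_mul_sProfile_rpow hs0 h0]
    positivity

theorem lintegral_ofReal_comp_abs {F : ℝ → ℝ} {k : ℝ} (hk : 0 < k)
    (hF : IntegrableOn F (Ioi 0)) (hF0 : ∀ x, 0 ≤ x → 0 ≤ F x) :
    ∫⁻ y, ENNReal.ofReal (F (k * |y|)) = ENNReal.ofReal (2 * (k⁻¹ * ∫ x in Ioi 0, F x)) := by
  have hi : IntegrableOn (fun y => F (k * y)) (Ioi 0) := by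
    rw [integrableOn_Ioi_comp_mul_left_iff F 0 hk, mul_zero]; exact hF
  rw [lintegral_even (fun x => by rw [abs_neg]), ENNReal.ofReal_mul zero_le_two,
    ENNReal.ofReal_ofNat]
  congr 1
  have := integral_comp_mul_left_Ioi F 0 hk
  rw [mul_zero, smul_eq_mul] at this
  rw [← this, ofReal_integral_eq_lintegral_ofReal hi
    ((ae_restrict_iff' measurableSet_Ioi).2 (Eventually.of_forall fun y hy =>
      hF0 _ (mul_nonneg hk.le (le_of_lt hy))))]
  refine setLIntegral_congr_fun measurableSet_Ioi fun y hy => ?_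
  rw [abs_of_pos hy]

theorem le_sPolar (hs0 : s < 0) (heven : Function.Even g) (h0 : 0 < g 0)
    (hf : IsProfile (sProfile s g)) (y : ℝ) :
    ENNReal.ofReal ((g 0 : ℝ)⁻¹ * (profileGauge (sProfile s g) (-s * |y|))⁻¹ ^ (-(1 / s))) ≤
      sPolar s g y := by
  refine le_iInf₂ fun x hx => ?_
  rw [if_neg hs0.ne]
  have h0' : (0 : ℝ) < g 0 := h0
  have hx' : (0 : ℝ) < g x := hx
  have hinv : 1 / s < 0 := one_div_neg.2 hs0
  rcases le_or_gt (1 - s * (x * y)) 0 with hT | hT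
  · rw [ENNReal.ofReal_of_nonpos hT, ENNReal.zero_rpow_of_neg hinv,
      ENNReal.top_div_of_ne_top ENNReal.coe_ne_top]
    exact le_top
  have hfx : 0 < sProfile s g x := (sProfile_pos_iff hs0 h0 x).2 hx
  have habs : sProfile s g |x| = sProfile s g x := by
    rcases abs_choice x with h | h <;> rw [h]
    rw [sProfile, sProfile, heven x]
  have hs' : 0 ≤ -s * |y| := mul_nonneg (by linarith) (abs_nonneg y)
  have hle : (1 - s * (x * y)) * sProfile s g x ≤ profileGauge (sProfile s g) (-s * |y|) := by
    refine le_trans ?_ (hf.le_gauge (abs_nonneg x) hs')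
    rw [habs]
    refine mul_le_mul_of_nonneg_right ?_ hfx.le
    have : x * y ≤ |x| * |y| := by rw [← abs_mul]; exact le_abs_self _
    nlinarith
  rw [ENNReal.ofReal_rpow_of_pos hT, ← ENNReal.ofReal_coe_nnreal (p := g x),
    ← ENNReal.ofReal_div_of_pos hx']
  refine ENNReal.ofReal_le_ofReal ?_
  have e : (1 - s * (x * y)) ^ (1 / s) / (g x : ℝ) =
      (g 0 : ℝ)⁻¹ * ((1 - s * (x * y)) * sProfile s g x)⁻¹ ^ (-(1 / s)) := by
    rw [eq_mul_sProfile_rpow hs0 h0 x, Real.inv_rpow (by positivity),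
      Real.mul_rpow hT.le hfx.le, Real.rpow_neg hT.le]
    have := Real.rpow_pos_of_pos hT (1 / s)
    have := Real.rpow_pos_of_pos hfx (-(1 / s))
    field_simp
  rw [e]
  have hm : 0 < (1 - s * (x * y)) * sProfile s g x := mul_pos hT hfx
  refine mul_le_mul_of_nonneg_left (Real.rpow_le_rpow (inv_nonneg.2 (hm.le.trans hle))
    (inv_anti₀ hm hle) (by linarith)) (by positivity)

theorem le_lintegral_sPolar (hs : -1 < s) (hs0 : s < 0) (heven : Function.Even g) (h0 : 0 < g 0)
    (hf : IsProfile (sProfile s g)) (hx : ∃ x > 0, 0 < sProfile s g x) :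
    ENNReal.ofReal (2 * ((-s)⁻¹ * ((g 0 : ℝ)⁻¹ *
      ∫ x in Ioi 0, (profileGauge (sProfile s g) x)⁻¹ ^ (-(1 / s))))) ≤
      ∫⁻ y, sPolar s g y := by
  have hp : 1 < -(1 / s) := by
    rw [← one_div_neg_eq_neg_one_div, lt_div_iff₀ (by linarith)]; linarith
  have h := lintegral_ofReal_comp_abs (neg_pos.2 hs0)
    (((hf.polar hx).integrableOn_rpow hp).const_mul (g 0 : ℝ)⁻¹)
    (fun x hx => mul_nonneg (by positivity)
      (Real.rpow_nonneg (inv_pos.2 (hf.gauge_pos hx)).le _))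
  rw [integral_const_mul] at h
  rw [← h]
  exact lintegral_mono fun y => le_sPolar hs0 heven h0 hf y

theorem sPolar_le_of_eq_indicator (hs0 : s < 0) {c : ℝ≥0} {a : ℝ} (hc : 0 < c) (ha : 0 < a)
    (hg : ∀ x : ℝ, x ≠ a → x ≠ -a → g x = (Icc (-a) a).indicator (fun _ => c) x) (y : ℝ) :
    sPolar s g y ≤ ENNReal.ofReal ((c : ℝ)⁻¹ * (1 + a * (-s * |y|))⁻¹ ^ (-(1 / s))) := by
  have hc' : (0 : ℝ) < c := hc
  have hpos : ∀ x, 0 ≤ x → 0 < 1 + x * (-s * |y|) := fun x hx => by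
    have := mul_nonneg hx (mul_nonneg (neg_pos.2 hs0).le (abs_nonneg y))
    linarith
  have hlim : Tendsto (fun x : ℝ => ENNReal.ofReal
      ((c : ℝ)⁻¹ * (1 + x * (-s * |y|))⁻¹ ^ (-(1 / s)))) (𝓝[<] a)
      (𝓝 (ENNReal.ofReal ((c : ℝ)⁻¹ * (1 + a * (-s * |y|))⁻¹ ^ (-(1 / s))))) := by
    refine ENNReal.tendsto_ofReal ?_
    have h1 : ContinuousAt (fun x : ℝ => (1 + x * (-s * |y|))⁻¹) a :=
      ContinuousAt.inv₀ (by fun_prop) (hpos a ha.le).ne'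
    exact ((h1.rpow_const (Or.inl (inv_pos.2 (hpos a ha.le)).ne')).const_mul _).tendsto.mono_left
      nhdsWithin_le_nhds
  refine ge_of_tendsto hlim ?_
  filter_upwards [Ioo_mem_nhdsLT ha] with x hx
  obtain ⟨x', hx'1, hx'2, hx'3, hx'4⟩ : ∃ x', x' * y = x * |y| ∧ x' ≠ a ∧ x' ≠ -a ∧
      x' ∈ Icc (-a) a := by
    rcases abs_choice y with h | h
    · exact ⟨x, by rw [h], hx.2.ne, by linarith [hx.1], by linarith [hx.1], hx.2.le⟩
    · exact ⟨-x, by rw [h]; ring, by linarith [hx.1], by linarith [hx.2],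
        by linarith [hx.2], by linarith [hx.1]⟩
  have hgx : g x' = c := by rw [hg x' hx'2 hx'3, indicator_of_mem hx'4]
  refine (iInf₂_le x' (hgx ▸ hc)).trans ?_
  have hT := hpos x hx.1.le
  have eT : 1 - s * (x' * y) = 1 + x * (-s * |y|) := by rw [hx'1]; ring
  rw [if_neg hs0.ne, hgx, eT, ENNReal.ofReal_rpow_of_pos hT, ← ENNReal.ofReal_coe_nnreal (p := c),
    ← ENNReal.ofReal_div_of_pos hc', Real.inv_rpow hT.le, Real.rpow_neg hT.le, inv_inv,
    div_eq_inv_mul]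

theorem lintegral_mul_le_of_eq_indicator (hs : -1 < s) (hs0 : s < 0) {c : ℝ≥0} {a : ℝ}
    (hc : 0 < c) (ha : 0 < a)
    (hg : ∀ x : ℝ, x ≠ a → x ≠ -a → g x = (Icc (-a) a).indicator (fun _ => c) x) :
    (∫⁻ x, (g x : ℝ≥0∞)) * ∫⁻ y, sPolar s g y ≤ ENNReal.ofReal (4 / (1 + s)) := by
  have hc' : (0 : ℝ) < c := hc
  have hp : 1 < -(1 / s) := by
    rw [← one_div_neg_eq_neg_one_div, lt_div_iff₀ (by linarith)]; linarith
  have h1 : ∫⁻ x, (g x : ℝ≥0∞) = ENNReal.ofReal (2 * a * c) := by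
    have : ∫⁻ x, (g x : ℝ≥0∞) = ∫⁻ x, (Icc (-a) a).indicator (fun _ => (c : ℝ≥0∞)) x := by
      refine lintegral_congr_ae ?_
      have hn : ∀ᵐ x : ℝ, x ≠ a ∧ x ≠ -a := by
        refine (Measure.ae_ne volume a).and (Measure.ae_ne volume (-a))
      filter_upwards [hn] with x hx
      rw [hg x hx.1 hx.2]
      by_cases h : x ∈ Icc (-a) a <;> simp [h]
    rw [this, lintegral_indicator_const measurableSet_Icc, Real.volume_Icc,
      ← ENNReal.ofReal_coe_nnreal, ← ENNReal.ofReal_mul c.coe_nonneg]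
    congr 1
    ring
  have h2 : ∫⁻ y, sPolar s g y ≤
      ENNReal.ofReal (2 * ((-s)⁻¹ * ((c : ℝ)⁻¹ * (1 / (a * (-(1 / s) - 1)))))) := by
    have h := lintegral_ofReal_comp_abs (neg_pos.2 hs0)
      ((IsProfile.integrableOn_affine_rpow hp ha).const_mul (c : ℝ)⁻¹)
      (fun x hx => by positivity)
    rw [integral_const_mul, IsProfile.integral_affine_rpow hp ha] at h
    rw [← h]
    exact lintegral_mono fun y => sPolar_le_of_eq_indicator hs0 hc ha hg y
  calc _ ≤ ENNReal.ofReal (2 * a * c) *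
        ENNReal.ofReal (2 * ((-s)⁻¹ * ((c : ℝ)⁻¹ * (1 / (a * (-(1 / s) - 1)))))) := by
        rw [h1]; gcongr
    _ = _ := by
        rw [← ENNReal.ofReal_mul (by positivity)]
        congr 1
        have e : -(1 / s) - 1 = (1 + s) / (-s) := by
          have := hs0.ne
          field_simp
          ring
        have := hs0.ne
        have : 1 + s ≠ 0 := by linarith
        rw [e]
        field_simp
        ring

end IsSConcave

theorem theorem1p6 (s : ℝ) (hs : -1 < s) (hs0 : s < 0) (g : ℝ → ℝ≥0)
    (heven : Function.Even g) (hconc : IsSConcave s g)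
    (hpos : 0 < ∫⁻ x, (g x : ℝ≥0∞)) (hfin : ∫⁻ x, (g x : ℝ≥0∞) < ∞) :
    ENNReal.ofReal (4 / (1 + s)) ≤ (∫⁻ x, (g x : ℝ≥0∞)) * ∫⁻ y, sPolar s g y ∧
    ((∫⁻ x, (g x : ℝ≥0∞)) * ∫⁻ y, sPolar s g y = ENNReal.ofReal (4 / (1 + s)) ↔
      ∃ (c : ℝ≥0) (a : ℝ), 0 < c ∧ 0 < a ∧
        ∀ x : ℝ, x ≠ a → x ≠ -a → g x = (Set.Icc (-a) a).indicator (fun _ => c) x) ∧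
    (UpperSemicontinuous g →
      ((∫⁻ x, (g x : ℝ≥0∞)) * ∫⁻ y, sPolar s g y = ENNReal.ofReal (4 / (1 + s)) ↔
        ∃ (c : ℝ≥0) (a : ℝ), 0 < c ∧ 0 < a ∧
          g = (Set.Icc (-a) a).indicator (fun _ => c))) := by
  have hanti := hconc.antitoneOn hs0 heven
  obtain ⟨x₀, hx₀, hgx₀⟩ := exists_pos_of_lintegral_pos heven hpos
  have h0 : 0 < g 0 := hgx₀.trans_le (hanti (mem_Ici.2 le_rfl) (mem_Ici.2 hx₀.le) hx₀.le)
  have h0' : (0 : ℝ) < g 0 := h0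
  have hf := hconc.isProfile hs0 heven h0 hfin
  have hex : ∃ x > 0, 0 < sProfile s g x :=
    ⟨x₀, hx₀, (IsSConcave.sProfile_pos_iff hs0 h0 x₀).2 hgx₀⟩
  have hp : 1 < -(1 / s) := by
    rw [← one_div_neg_eq_neg_one_div, lt_div_iff₀ (by linarith)]; linarith
  obtain ⟨n, hn⟩ := exists_nat_ge (-(1 / s))
  obtain ⟨hmain, hflat⟩ := hf.one_le_integral_mul hex n (-(1 / s)) hp (by linarith)
  have hI := IsSConcave.lintegral_eq hs hs0 heven h0 hf
  have hJ := IsSConcave.le_lintegral_sPolar hs hs0 heven h0 hf hex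
  have hG0 := hf.integral_rpow_nonneg (-(1 / s))
  set G := ∫ x in Ioi 0, sProfile s g x ^ (-(1 / s))
  set H := ∫ x in Ioi 0, (profileGauge (sProfile s g) x)⁻¹ ^ (-(1 / s))
  have hs1 : 0 < 1 + s := by linarith
  have hge : ENNReal.ofReal (4 * (-s)⁻¹ * (G * H)) ≤
      (∫⁻ x, (g x : ℝ≥0∞)) * ∫⁻ y, sPolar s g y := by
    refine le_trans (le_of_eq ?_) (mul_le_mul_right hJ _)
    rw [hI, ← ENNReal.ofReal_mul (by positivity)]
    congr 1
    field_simp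
    ring
  have e : -(1 / s) - 1 = (1 + s) / (-s) := by
    have := hs0.ne
    field_simp
    ring
  rw [e] at hmain hflat
  have hns : 0 < -s := neg_pos.2 hs0
  have hconst : 4 * (-s)⁻¹ * (G * H) = 4 / (1 + s) * ((1 + s) / (-s) * (G * H)) := by
    field_simp
  have hlower : ENNReal.ofReal (4 / (1 + s)) ≤ (∫⁻ x, (g x : ℝ≥0∞)) * ∫⁻ y, sPolar s g y := by
    refine le_trans (ENNReal.ofReal_le_ofReal ?_) hge
    rw [hconst]
    exact le_mul_of_one_le_right (by positivity) hmain
  have hiff : (∫⁻ x, (g x : ℝ≥0∞)) * ∫⁻ y, sPolar s g y = ENNReal.ofReal (4 / (1 + s)) ↔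
      ∃ (c : ℝ≥0) (a : ℝ), 0 < c ∧ 0 < a ∧
        ∀ x : ℝ, x ≠ a → x ≠ -a → g x = (Set.Icc (-a) a).indicator (fun _ => c) x := by
    constructor
    · intro he
      rw [he, hconst, ENNReal.ofReal_le_ofReal_iff (by positivity)] at hge
      have h1 := (mul_le_iff_le_one_right (by positivity : (0 : ℝ) < 4 / (1 + s))).1 hge
      obtain ⟨a, ha, hin, hout⟩ := hflat (le_antisymm h1 hmain)
      refine ⟨g 0, a, h0, ha, fun x hxa hxa' => ?_⟩
      have habs : g |x| = g x := by rcases abs_choice x with h | h <;> rw [h]; exact heven x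
      have hg := IsSConcave.eq_mul_sProfile_rpow hs0 h0 |x|
      rw [habs] at hg
      rcases lt_or_gt_of_ne (show |x| ≠ a from fun h => by
        rcases abs_choice x with h' | h'
        · exact hxa (h' ▸ h)
        · exact hxa' (by linarith)) with h | h
      · rw [indicator_of_mem (mem_Icc.2 (abs_le.1 h.le))]
        rw [hin _ (abs_nonneg x) h, Real.one_rpow, mul_one] at hg
        exact_mod_cast hg
      · rw [indicator_of_notMem fun hc => absurd (abs_le.2 (mem_Icc.1 hc)) (not_le.2 h)]
        rw [hout _ h, Real.zero_rpow (by linarith), mul_zero] at hg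
        exact_mod_cast hg
    · rintro ⟨c, a, hc, ha, hg⟩
      exact le_antisymm (IsSConcave.lintegral_mul_le_of_eq_indicator hs hs0 hc ha hg) hlower
  refine ⟨hlower, hiff, fun husc => hiff.trans ⟨?_, ?_⟩⟩
  · rintro ⟨c, a, hc, ha, hg⟩
    have hin : ∀ x, 0 ≤ x → x < a → g x = c := fun x hx hxa => by
      rw [hg x hxa.ne (by linarith), indicator_of_mem (mem_Icc.2 ⟨by linarith, hxa.le⟩)]
    have hga : g a = c := by
      refine le_antisymm ?_ ?_
      · rw [← hin 0 le_rfl ha]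
        exact hanti (mem_Ici.2 le_rfl) (mem_Ici.2 ha.le) ha.le
      · by_contra! hlt
        have h1 := (husc a c hlt).filter_mono (nhdsWithin_le_nhds (s := Iio a))
        obtain ⟨x, hx1, hx2⟩ := (h1.and (Ioo_mem_nhdsLT ha)).exists
        rw [hin x hx2.1.le hx2.2] at hx1
        exact lt_irrefl _ hx1
    refine ⟨c, a, hc, ha, funext fun x => ?_⟩
    by_cases hxa : x = a
    · rw [hxa, hga, indicator_of_mem (right_mem_Icc.2 (by linarith))]
    by_cases hxa' : x = -a
    · rw [hxa', heven, hga, indicator_of_mem (left_mem_Icc.2 (by linarith))]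
    exact hg x hxa hxa'
  · rintro ⟨c, a, hc, ha, hg⟩
    exact ⟨c, a, hc, ha, fun x _ _ => by rw [hg]⟩
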